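/- **Conventions.** A vocabulary $\tau$ is a non-empty finite set of relation symbols (each with an arity in $\mathbb N$), and a $\tau$-structure $\mathcal A$ has a non-empty finite domain $V(\mathcal A)$ of size $|\mathcal A|$. Its two-sorted extension $\mathcal A^+$ adds the number sort $N(\mathcal A)=\{0,\dots,|\mathcal A|\}$ with the linear order $\le$, the successor relation $S$, and the unary singleton relations $\min$ and $\max$. Domain variables $x_1,x_2,\dots$ range over $V(\mathcal A)$, number variables over $N(\mathcal A)$. *The logic $\mathsf{STC{+}C}[\tau]$* (symmetric transitive closure logic with counting) is interpreted in $\mathcal A^+$. Its formulae are built from the atoms $x=y$, $R(\bar x)$ $(R\in\tau)$, $\iota=\kappa$, $\iota\le\kappa$, $S(\iota,\kappa)$, $\min(\iota)$, $\max(\iota)$ by $\neg$, $\vee$, $\exists x$, $\exists\iota$, the counting formulae $\#x\,\varphi=\kappa$ and $\#\iota\,\varphi=\kappa$ (the number of witnesses in $V(\mathcal A)$, respectively in $N(\mathcal A)$, equals the value of $\kappa$), and the operator $[\mathsf{stc}_{\bar z,\bar z'}\,\varphi](\bar u,\bar u')$. Here $\bar z,\bar z',\bar u,\bar u'$ are mixed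 tuples of domain and number variables, all of the same type, and the variables in $\bar z\bar z'$ are pairwise distinct and become bound in $\varphi$. The last formula says that the values of $(\bar u,\bar u')$ lie in the symmetric transitive closure of the relation which $\varphi$ defines (for the given values of its other free variables) on pairs of mixed tuples, that is, in the least symmetric and transitive relation containing it. *The logic $\mathsf C[\tau]$* extends first-order logic over $\tau$ by the quantifiers $\exists^{\ge m}x$ $(m\in\mathbb N)$. For $k,r\in\mathbb N$, $\mathsf C^k_r$ is the set of its formulae in which only the variables $x_1,\dots,x_k$ occur (free or bound) and whose quantifier depth (counting both $\exists x$ and $\exists^{\ge m}x$) is at most $r$. We write $\varphi(\bar x,\bar\iota)$ to say that $\bar x$ and $\bar\iota$ are tuples of pairwise distinct variables that include all free variables of $\varphi$. **Lemma.** For every vocabulary $\tau$ and every $\mathsf{STC{+}C}[\tau]$-formula $\varphi(\bar x,\bar\iota)$, with $\bar x$ a tuple of domain variables and $\bar\iota$ a tuple of number variables, there are a constant $k\in\mathbb N$ and a function $f:\mathbb N\to\mathbb N$ with $f(n)\in O(\log n)$ such that for every $n\in\mathbb N$ there is a family $$\bigl(\psi_{\bar i}(\bar x)\bigr)_{\bar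 i\in\{0,\dots,n\}^{|\bar\iota|}}$$ of $\mathsf C^k_{f(n)}[\tau]$-formulae such that for all $\tau$-structures $\mathcal A$ of size $|\mathcal A|\le n$, all $\bar v\in V(\mathcal A)^{|\bar x|}$ and all $\bar i\in N(\mathcal A)^{|\bar\iota|}$, $$\mathcal A^+\models\varphi(\bar v,\bar i)\iff\mathcal A\models\psi_{\bar i}(\bar v).$$ -/

import Mathlib

open Asymptotics Filter

universe u v w

/-! Variables are indexed by natural numbers: the index `i` stands for the domain variable
`x_{i+1}`, respectively for the number variable `ι_{i+1}`. A vocabulary is a relational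
first-order language with finitely many (and at least one) symbols. -/

/-- The number sort `N(A) = {0, …, |A|}` of the two-sorted structure extending `A`. -/
abbrev NumSort (A : Type w) : Type := Fin (Nat.card A + 1)

/-- Formulae of the logic `C` over the vocabulary `L`: first-order logic with
counting quantifiers `∃^{≥ m} x`. -/
inductive CFormula (L : FirstOrder.Language.{u, v}) : Type v
  /-- `x = y` -/
  | eq (x y : ℕ) : CFormula L
  /-- `R(x_1, …, x_r)` -/
  | rel {r : ℕ} (R : L.Relations r) (x : Fin r → ℕ) : CFormula L
  | not (φ : CFormula L) : CFormula L
  | or (φ ψ : CFormula L) : CFormula L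
  /-- `∃ x φ` -/
  | ex (x : ℕ) (φ : CFormula L) : CFormula L
  /-- `∃^{≥ m} x φ` -/
  | exGe (m : ℕ) (x : ℕ) (φ : CFormula L) : CFormula L

namespace CFormula

variable {L : FirstOrder.Language.{u, v}}

/-- All variables that are used in a formula, free or bound. -/
def vars : CFormula L → Set ℕ
  | eq x y => {x, y}
  | rel _ x => Set.range x
  | not φ => φ.vars
  | or φ ψ => φ.vars ∪ ψ.vars
  | ex x φ => insert x φ.vars
  | exGe _ x φ => insert x φ.vars

/-- The free variables of a formula. -/
def free : CFormula L → Set ℕ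
  | eq x y => {x, y}
  | rel _ x => Set.range x
  | not φ => φ.free
  | or φ ψ => φ.free ∪ ψ.free
  | ex x φ => φ.free \ {x}
  | exGe _ x φ => φ.free \ {x}

/-- The quantifier depth of a formula. -/
def qd : CFormula L → ℕ
  | eq _ _ => 0
  | rel _ _ => 0
  | not φ => φ.qd
  | or φ ψ => max φ.qd ψ.qd
  | ex _ φ => φ.qd + 1
  | exGe _ _ φ => φ.qd + 1

/-- `(A, α) ⊨ φ`. -/
def Sat {A : Type w} [L.Structure A] : CFormula L → (ℕ → A) → Prop
  | eq x y, α => α x = α y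
  | rel R x, α => FirstOrder.Language.Structure.RelMap R (fun i => α (x i))
  | not φ, α => ¬ φ.Sat α
  | or φ ψ, α => φ.Sat α ∨ ψ.Sat α
  | ex x φ, α => ∃ a : A, φ.Sat (Function.update α x a)
  | exGe m x φ, α => (m : ℕ∞) ≤ {a : A | φ.Sat (Function.update α x a)}.encard

end CFormula

/-- `C^k_r`: the formulae of `C` that use only the first `k` variables and have quantifier
depth at most `r`. -/
def CLogic (L : FirstOrder.Language.{u, v}) (k r : ℕ) : Set (CFormula L) :=
  {φ | (∀ i ∈ φ.vars, i < k) ∧ φ.qd ≤ r}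

/-- Formulae of `STC+C` over the vocabulary `L`: first-order logic over the two-sorted structure
extending an `L`-structure (with equality and the relations `≤`, `S`, `min`, `max` on the number
sort), with counting formulae `# x φ = κ` and `# ι φ = κ` and with the `stc`-operator over mixed
domain/number tuples. -/
inductive STCCFormula (L : FirstOrder.Language.{u, v}) : Type v
  /-- `x = y` -/
  | eq (x y : ℕ) : STCCFormula L
  /-- `R(x_1, …, x_r)` -/
  | rel {r : ℕ} (R : L.Relations r) (x : Fin r → ℕ) : STCCFormula L
  /-- `ι = κ` -/
  | numEq (ι κ : ℕ) : STCCFormula L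
  /-- `ι ≤ κ` -/
  | numLe (ι κ : ℕ) : STCCFormula L
  /-- `S(ι, κ)`: `κ` is the successor of `ι` -/
  | numSucc (ι κ : ℕ) : STCCFormula L
  /-- `min(ι)` -/
  | numMin (ι : ℕ) : STCCFormula L
  /-- `max(ι)` -/
  | numMax (ι : ℕ) : STCCFormula L
  | not (φ : STCCFormula L) : STCCFormula L
  | or (φ ψ : STCCFormula L) : STCCFormula L
  /-- `∃ x φ` for a domain variable `x` -/
  | exDom (x : ℕ) (φ : STCCFormula L) : STCCFormula L
  /-- `∃ ι φ` for a number variable `ι` -/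
  | exNum (ι : ℕ) (φ : STCCFormula L) : STCCFormula L
  /-- `# x φ = κ` for a domain variable `x` -/
  | countDom (x : ℕ) (φ : STCCFormula L) (κ : ℕ) : STCCFormula L
  /-- `# ι φ = κ` for a number variable `ι` -/
  | countNum (ι : ℕ) (φ : STCCFormula L) (κ : ℕ) : STCCFormula L
  /-- `[stc_{x̄ ῑ, ȳ κ̄} φ](x̄' ῑ', ȳ' κ̄')`, where the bound domain variables `x̄ ȳ` are pairwise
  distinct, and so are the bound number variables `ῑ κ̄`. -/
  | stc {k l : ℕ} (x y : Fin k → ℕ) (ι κ : Fin l → ℕ)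
      (hdom : Function.Injective (Sum.elim x y)) (hnum : Function.Injective (Sum.elim ι κ))
      (φ : STCCFormula L) (x' y' : Fin k → ℕ) (ι' κ' : Fin l → ℕ) : STCCFormula L

namespace STCCFormula

variable {L : FirstOrder.Language.{u, v}}

/-- The free domain variables of a formula. -/
def freeDom : STCCFormula L → Set ℕ
  | eq x y => {x, y}
  | rel _ x => Set.range x
  | numEq _ _ => ∅
  | numLe _ _ => ∅
  | numSucc _ _ => ∅
  | numMin _ => ∅
  | numMax _ => ∅
  | not φ => φ.freeDom
  | or φ ψ => φ.freeDom ∪ ψ.freeDom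
  | exDom x φ => φ.freeDom \ {x}
  | exNum _ φ => φ.freeDom
  | countDom x φ _ => φ.freeDom \ {x}
  | countNum _ φ _ => φ.freeDom
  | stc x y _ _ _ _ φ x' y' _ _ =>
      (φ.freeDom \ (Set.range x ∪ Set.range y)) ∪ (Set.range x' ∪ Set.range y')

/-- The free number variables of a formula. -/
def freeNum : STCCFormula L → Set ℕ
  | eq _ _ => ∅
  | rel _ _ => ∅
  | numEq ι κ => {ι, κ}
  | numLe ι κ => {ι, κ}
  | numSucc ι κ => {ι, κ}
  | numMin ι => {ι}
  | numMax ι => {ι}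
  | not φ => φ.freeNum
  | or φ ψ => φ.freeNum ∪ ψ.freeNum
  | exDom _ φ => φ.freeNum
  | exNum ι φ => φ.freeNum \ {ι}
  | countDom _ φ κ => insert κ φ.freeNum
  | countNum ι φ κ => insert κ (φ.freeNum \ {ι})
  | stc _ _ ι κ _ _ φ _ _ ι' κ' =>
      (φ.freeNum \ (Set.range ι ∪ Set.range κ)) ∪ (Set.range ι' ∪ Set.range κ')

/-- `(A⁺, α) ⊨ φ`, where `A⁺` is the two-sorted structure extending the finite structure `A`; the
assignment is given by its domain part `α` and its number part `β`. For the `stc`-operator, `φ`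
defines a relation `E` on the mixed tuples, and the pair of tuples named by the arguments has to
lie in the symmetric transitive closure of `E`, the least symmetric and transitive relation that
contains `E`. Here `Function.extend x a α` is the assignment `α[a/x]`. -/
def Sat {A : Type w} [L.Structure A] :
    STCCFormula L → (ℕ → A) → (ℕ → NumSort A) → Prop
  | eq x y, α, _ => α x = α y
  | rel R x, α, _ => FirstOrder.Language.Structure.RelMap R (fun i => α (x i))
  | numEq ι κ, _, β => β ι = β κ
  | numLe ι κ, _, β => β ι ≤ β κ
  | numSucc ι κ, _, β => (β κ : ℕ) = (β ι : ℕ) + 1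
  | numMin ι, _, β => (β ι : ℕ) = 0
  | numMax ι, _, β => (β ι : ℕ) = Nat.card A
  | not φ, α, β => ¬ φ.Sat α β
  | or φ ψ, α, β => φ.Sat α β ∨ ψ.Sat α β
  | exDom x φ, α, β => ∃ a : A, φ.Sat (Function.update α x a) β
  | exNum ι φ, α, β => ∃ i : NumSort A, φ.Sat α (Function.update β ι i)
  | countDom x φ κ, α, β => {a : A | φ.Sat (Function.update α x a) β}.encard = ((β κ : ℕ) : ℕ∞)
  | countNum ι φ κ, α, β =>
      {i : NumSort A | φ.Sat α (Function.update β ι i)}.encard = ((β κ : ℕ) : ℕ∞)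
  | stc (k := k) (l := l) x y ι κ _ _ φ x' y' ι' κ', α, β =>
      let E : (Fin k → A) × (Fin l → NumSort A) → (Fin k → A) × (Fin l → NumSort A) → Prop :=
        fun s t => φ.Sat (Function.extend (Sum.elim x y) (Sum.elim s.1 t.1) α)
          (Function.extend (Sum.elim ι κ) (Sum.elim s.2 t.2) β)
      Relation.TransGen (fun s t => E s t ∨ E t s)
        (fun i => α (x' i), fun j => β (ι' j)) (fun i => α (y' i), fun j => β (κ' j))

end STCCFormula

/-! Once a bound `n` on the size is fixed, number values can be treated as constants. By induction
on the formula, every number assignment `b` receives its own `C`-formula. Number quantifiers become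
finite disjunctions over `0, …, n`, guarded by "the domain has at least `m` elements"; such Boolean
combinations may be huge, but use no further variables and no further quantifier depth. The only
source of logarithmic depth is `stc`. For tuples of type `(k, l)` there are at most `2 ^ ((k + l) *
n.size)` mixed tuples, so transitive closure is reached after `(k + l) * n.size` rounds of repeated
squaring (`Relation.transGen_iff_squaring`). Each round guesses a midpoint: its domain part by `k`
quantifiers, its number part by a disjunction. The previous round's formula is then applied to
renamed arguments (`CFormula.sat_subst`, `CFormula.sat_reach`). The renaming reuses the same
auxiliary variables in every round, so their number stays constant and each round adds constant
depth. Nested `stc`-operators add their depths, which keeps the total below a constant times `n.size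
+ 1` (`STCCFormula.translatable`). -/

/-! ### Path lengths and repeated squaring. -/

namespace Relation

variable {X : Type*}

/-- `Steps r j a b`: there is an `r`-path with exactly `j` steps from `a` to `b`. -/
def Steps (r : X → X → Prop) : ℕ → X → X → Prop
  | 0, a, b => a = b
  | j + 1, a, b => ∃ m, Steps r j a m ∧ r m b

theorem steps_add (r : X → X → Prop) (i j : ℕ) (a b : X) :
    Steps r (i + j) a b ↔ ∃ m, Steps r i a m ∧ Steps r j m b := by
  induction j generalizing b with
  | zero => simp [Steps]
  | succ j ih =>
    rw [← add_assoc]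
    simp only [Steps, ih]
    constructor
    · rintro ⟨m, ⟨m', h1, h2⟩, h3⟩
      exact ⟨m', h1, m, h2, h3⟩
    · rintro ⟨m', h1, m, h2, h3⟩
      exact ⟨m, ⟨m', h1, h2⟩, h3⟩

theorem transGen_iff_exists_steps (r : X → X → Prop) (a b : X) :
    TransGen r a b ↔ ∃ j, 1 ≤ j ∧ Steps r j a b := by
  constructor
  · intro h
    induction h with
    | single h => exact ⟨1, le_rfl, a, rfl, h⟩
    | tail _ h ih =>
      obtain ⟨j, _, hj⟩ := ih
      exact ⟨j + 1, by omega, _, hj, h⟩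
  · rintro ⟨j, hj, h⟩
    induction j, hj using Nat.le_induction generalizing b with
    | base =>
      obtain ⟨m, rfl, h⟩ := h
      exact .single h
    | succ j _ ih =>
      obtain ⟨m, hm, h⟩ := h
      exact (ih m hm).tail h

/-- A path in a finite relation can be shortened to one with at most as many steps as there
are points. -/
theorem transGen_iff_exists_steps_le [Finite X] (r : X → X → Prop) (a b : X) :
    TransGen r a b ↔ ∃ j, 1 ≤ j ∧ j ≤ Nat.card X ∧ Steps r j a b := by
  classical
  rw [transGen_iff_exists_steps]
  refine ⟨fun h => ?_, fun ⟨j, h1, _, h2⟩ => ⟨j, h1, h2⟩⟩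
  obtain ⟨h1, h2⟩ := Nat.find_spec h
  have hmin := fun m => @Nat.find_min _ _ h m
  generalize Nat.find h = j at h1 h2 hmin
  refine ⟨j, h1, ?_, h2⟩
  by_contra! hj
  -- Pigeonhole on the points after `1, …, j` steps. Leaving out the starting point gives the bound
  -- `Nat.card X` and ensures that at least one step survives the cut, which matters when `a = b`.
  have key : ∀ i : Fin j, ∃ m, Steps r (i + 1) a m ∧ Steps r (j - (i + 1)) m b := by
    intro i
    rw [← steps_add]
    convert h2 using 1
    omega
  choose g hg1 hg2 using key
  have hinj : ¬ Function.Injective g := by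
    intro hg
    have := Nat.card_le_card_of_injective g hg
    simp only [Nat.card_fin] at this
    omega
  have hlt : ∃ i i' : Fin j, i < i' ∧ g i = g i' := by
    simp only [Function.Injective, not_forall] at hinj
    obtain ⟨i, i', he, hne⟩ := hinj
    rcases lt_or_gt_of_ne hne with h | h
    · exact ⟨i, i', h, he⟩
    · exact ⟨i', i, h, he.symm⟩
  obtain ⟨i, i', hlt, he⟩ := hlt
  refine hmin (i + 1 + (j - (i' + 1))) (by omega) ⟨by omega, ?_⟩
  rw [steps_add]
  exact ⟨g i, hg1 i, he ▸ hg2 i'⟩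

/-- Reachability in at least one and at most `2 ^ d` steps, by repeated squaring. -/
def Squaring (r : X → X → Prop) : ℕ → X → X → Prop
  | 0, a, b => r a b
  | d + 1, a, b => Squaring r d a b ∨ ∃ m, Squaring r d a m ∧ Squaring r d m b

theorem squaring_iff (r : X → X → Prop) (d : ℕ) (a b : X) :
    Squaring r d a b ↔ ∃ j, 1 ≤ j ∧ j ≤ 2 ^ d ∧ Steps r j a b := by
  induction d generalizing a b with
  | zero =>
    constructor
    · intro h
      exact ⟨1, le_rfl, by simp, a, rfl, h⟩
    · rintro ⟨j, h1, h2, h⟩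
      obtain rfl : j = 1 := by simp at h2; omega
      obtain ⟨m, rfl, h⟩ := h
      exact h
  | succ d ih =>
    simp only [Squaring, ih, pow_succ]
    constructor
    · rintro (⟨j, h1, h2, h⟩ | ⟨m, ⟨j, h1, h2, h⟩, ⟨j', h1', h2', h'⟩⟩)
      · exact ⟨j, h1, by omega, h⟩
      · exact ⟨j + j', by omega, by omega, (steps_add r j j' a b).2 ⟨m, h, h'⟩⟩
    · rintro ⟨j, h1, h2, h⟩
      by_cases hj : j ≤ 2 ^ d
      · exact Or.inl ⟨j, h1, hj, h⟩
      -- The midpoint is the point after exactly `2 ^ d` steps; the rest is nonempty because `j > 2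
      -- ^ d`.
      · have e : j = 2 ^ d + (j - 2 ^ d) := by omega
        rw [e, steps_add] at h
        obtain ⟨m, hm, hm'⟩ := h
        exact Or.inr ⟨m, ⟨2 ^ d, Nat.one_le_two_pow, le_rfl, hm⟩,
          ⟨j - 2 ^ d, by omega, by omega, hm'⟩⟩

theorem transGen_iff_squaring [Finite X] (r : X → X → Prop) {d : ℕ} (hd : Nat.card X ≤ 2 ^ d)
    (a b : X) : TransGen r a b ↔ Squaring r d a b := by
  rw [squaring_iff]
  constructor
  · rw [transGen_iff_exists_steps_le]
    rintro ⟨j, h1, h2, h⟩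
    exact ⟨j, h1, h2.trans hd, h⟩
  · rintro ⟨j, h1, _, h⟩
    exact (transGen_iff_exists_steps r a b).2 ⟨j, h1, h⟩

end Relation

/-! ### Assignments modified along a tuple of variables. -/

namespace Function

variable {J V B : Type*}

theorem extend_eq_of_notMem_range (v : J → V) (c : J → B) (α : V → B) {i : V}
    (hi : i ∉ Set.range v) : extend v c α i = α i :=
  extend_apply' _ _ _ (by simpa using hi)

theorem extend_comp_self_of_agree {v : J → V} (hv : Injective v) {α α' : V → B}
    (h : ∀ i, i ∉ Set.range v → α' i = α i) : extend v (α' ∘ v) α = α' := by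
  funext i
  by_cases hi : i ∈ Set.range v
  · obtain ⟨j, rfl⟩ := hi
    rw [hv.extend_apply, comp_apply]
  · rw [extend_eq_of_notMem_range _ _ _ hi, h i hi]

end Function

/-! ### Building `C`-formulae while tracking variables, depth and free variables. -/

namespace CFormula

variable {L : FirstOrder.Language.{u, v}}

theorem free_subset_vars (φ : CFormula L) : φ.free ⊆ φ.vars := by
  induction φ with
  | eq x y => exact subset_rfl
  | rel R x => exact subset_rfl
  | not φ ih => exact ih
  | or φ ψ ih1 ih2 => exact Set.union_subset_union ih1 ih2
  | ex x φ ih => exact Set.sdiff_subset.trans (ih.trans (Set.subset_insert _ _))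
  | exGe m x φ ih => exact Set.sdiff_subset.trans (ih.trans (Set.subset_insert _ _))

theorem sat_congr {A : Type w} [L.Structure A] (φ : CFormula L) {α α' : ℕ → A}
    (h : ∀ i ∈ φ.free, α i = α' i) : φ.Sat α ↔ φ.Sat α' := by
  have upd : ∀ (ψ : CFormula L) (x : ℕ) (α α' : ℕ → A) (a : A),
      (∀ i ∈ ψ.free \ {x}, α i = α' i) →
      ∀ i ∈ ψ.free, Function.update α x a i = Function.update α' x a i := by
    intro ψ x α α' a h i hi
    by_cases hx : i = x
    · subst hx; simp
    · simp only [Function.update_of_ne hx]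
      exact h i ⟨hi, hx⟩
  induction φ generalizing α α' with
  | eq x y => simp only [Sat]; rw [h x (by simp [free]), h y (by simp [free])]
  | rel R x =>
    simp only [Sat]
    have : (fun i => α (x i)) = fun i => α' (x i) := funext fun i => h _ ⟨i, rfl⟩
    rw [this]
  | not φ ih => exact not_congr (ih h)
  | or φ ψ ih1 ih2 =>
    exact or_congr (ih1 fun i hi => h i (Or.inl hi)) (ih2 fun i hi => h i (Or.inr hi))
  | ex x φ ih => exact exists_congr fun a => ih (upd φ x α α' a h)
  | exGe m x φ ih =>
    simp only [Sat]
    have : {a : A | φ.Sat (Function.update α x a)} = {a : A | φ.Sat (Function.update α' x a)} :=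
      Set.ext fun a => ih (upd φ x α α' a h)
    rw [this]

/-- The formula uses only the first `k` variables, has quantifier depth at most `r`, and all
its free variables are in `F`. -/
structure Fits (k r : ℕ) (F : Set ℕ) (φ : CFormula L) : Prop where
  vars_lt : ∀ i ∈ φ.vars, i < k
  qd_le : φ.qd ≤ r
  free_subset : φ.free ⊆ F

namespace Fits

variable {k k' r r' : ℕ} {F F' : Set ℕ} {φ ψ : CFormula L}

theorem mono (h : Fits k r F φ) (hk : k ≤ k') (hr : r ≤ r') (hF : F ⊆ F') : Fits k' r' F' φ :=
  ⟨fun i hi => (h.1 i hi).trans_le hk, h.2.trans hr, h.3.trans hF⟩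

theorem eq {x y : ℕ} (hx : x < k) (hy : y < k) (hxF : x ∈ F) (hyF : y ∈ F) :
    Fits k r F (.eq x y : CFormula L) := by
  refine ⟨?_, Nat.zero_le _, ?_⟩
  · rintro i (rfl | rfl) <;> assumption
  · rintro i (rfl | rfl) <;> assumption

theorem not (h : Fits k r F φ) : Fits k r F φ.not := ⟨h.1, h.2, h.3⟩

theorem or (h : Fits k r F φ) (h' : Fits k r F ψ) : Fits k r F (φ.or ψ) :=
  ⟨fun i hi => hi.elim (h.1 i) (h'.1 i), max_le h.2 h'.2, Set.union_subset h.3 h'.3⟩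

theorem ex {x : ℕ} (h : Fits k r F φ) (hx : x < k) : Fits k (r + 1) (F \ {x}) (φ.ex x) :=
  ⟨fun i hi => hi.elim (fun e => e ▸ hx) (h.1 i), Nat.succ_le_succ h.2,
    Set.sdiff_subset_sdiff_left h.3⟩

theorem exGe {x : ℕ} (m : ℕ) (h : Fits k r F φ) (hx : x < k) :
    Fits k (r + 1) (F \ {x}) (φ.exGe m x) :=
  ⟨fun i hi => hi.elim (fun e => e ▸ hx) (h.1 i), Nat.succ_le_succ h.2,
    Set.sdiff_subset_sdiff_left h.3⟩

end Fits

/-- Conjunction. -/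
def and (φ ψ : CFormula L) : CFormula L := not (or (not φ) (not ψ))

@[simp] theorem sat_and {A : Type w} [L.Structure A] (φ ψ : CFormula L) (α : ℕ → A) :
    (and φ ψ).Sat α ↔ φ.Sat α ∧ ψ.Sat α := by
  simp only [and, Sat]; tauto

theorem Fits.and {k r : ℕ} {F : Set ℕ} {φ ψ : CFormula L} (h : Fits k r F φ)
    (h' : Fits k r F ψ) : Fits k r F (φ.and ψ) := (h.not.or h'.not).not

/-- The domain has at least `m` elements. -/
def cardGe (m : ℕ) : CFormula L := exGe m 0 (eq 0 0)

-- This makes `cardGe m` the guard for number values: it says that the constant `m` belongs to the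
-- number sort.
@[simp] theorem sat_cardGe {A : Type w} [L.Structure A] [Finite A] (m : ℕ) (α : ℕ → A) :
    (cardGe m : CFormula L).Sat α ↔ m ≤ Nat.card A := by
  have : {a : A | (eq 0 0 : CFormula L).Sat (Function.update α 0 a)} = Set.univ := by
    ext a; simp [Sat]
  rw [cardGe, Sat, this, Set.encard_univ, ENat.card_eq_coe_natCard, Nat.cast_le]

/-- The guard spends one quantifier. This is the origin of the hypothesis `0 < r` in the lemmas on
`const`, `disj` and `conj`. -/
theorem Fits.cardGe {k r : ℕ} {F : Set ℕ} (m : ℕ) (hk : 0 < k) (hr : 0 < r) :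
    Fits k r F (cardGe m : CFormula L) :=
  ((Fits.eq (r := 0) (F := {0}) hk hk rfl rfl).exGe m hk).mono le_rfl hr (by simp)

/-- A formula that is always true (if `p` holds), respectively always false. -/
def const (p : Prop) [Decidable p] : CFormula L := if p then cardGe 0 else not (cardGe 0)

@[simp] theorem sat_const {A : Type w} [L.Structure A] [Finite A] (p : Prop) [Decidable p]
    (α : ℕ → A) : (const p : CFormula L).Sat α ↔ p := by
  unfold const
  split_ifs with h <;> simp [h, Sat]

theorem Fits.const {k r : ℕ} {F : Set ℕ} (p : Prop) [Decidable p] (hk : 0 < k) (hr : 0 < r) :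
    Fits k r F (const p : CFormula L) := by
  unfold CFormula.const
  split_ifs
  · exact .cardGe 0 hk hr
  · exact (Fits.cardGe 0 hk hr).not

/-- The disjunction of a finite family of formulae. -/
noncomputable def disj {I : Type*} (s : Finset I) (f : I → CFormula L) : CFormula L :=
  s.toList.foldr (fun i φ => or (f i) φ) (const False)

@[simp] theorem sat_disj {I : Type*} {A : Type w} [L.Structure A] [Finite A] (s : Finset I)
    (f : I → CFormula L) (α : ℕ → A) : (disj s f).Sat α ↔ ∃ i ∈ s, (f i).Sat α := by
  simp only [← Finset.mem_toList, disj]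
  induction s.toList with
  | nil => simp
  | cons i l ih => simp [Sat, ih]

theorem Fits.disj {I : Type*} {k r : ℕ} {F : Set ℕ} {s : Finset I} {f : I → CFormula L}
    (hk : 0 < k) (hr : 0 < r) (h : ∀ i ∈ s, Fits k r F (f i)) : Fits k r F (disj s f) := by
  have h : ∀ i ∈ s.toList, Fits k r F (f i) := fun i hi => h i (Finset.mem_toList.1 hi)
  unfold CFormula.disj
  generalize s.toList = l at h
  induction l with
  | nil => exact .const False hk hr
  | cons i l ih =>
    simp only [List.mem_cons, forall_eq_or_imp] at h
    exact h.1.or (ih h.2)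

/-- The conjunction of a finite family of formulae. -/
noncomputable def conj {I : Type*} (s : Finset I) (f : I → CFormula L) : CFormula L :=
  not (disj s fun i => not (f i))

@[simp] theorem sat_conj {I : Type*} {A : Type w} [L.Structure A] [Finite A] (s : Finset I)
    (f : I → CFormula L) (α : ℕ → A) : (conj s f).Sat α ↔ ∀ i ∈ s, (f i).Sat α := by
  simp [conj, Sat]

theorem Fits.conj {I : Type*} {k r : ℕ} {F : Set ℕ} {s : Finset I} {f : I → CFormula L}
    (hk : 0 < k) (hr : 0 < r) (h : ∀ i ∈ s, Fits k r F (f i)) : Fits k r F (conj s f) :=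
  (Fits.disj hk hr fun i hi => (h i hi).not).not

/-- Existential quantification over a tuple of variables. -/
noncomputable def exs {J : Type*} [Fintype J] (v : J → ℕ) (φ : CFormula L) : CFormula L :=
  (Finset.univ.toList (α := J)).foldr (fun j ψ => ex (v j) ψ) φ

theorem sat_exs {J : Type*} [Fintype J] {A : Type w} [L.Structure A] {v : J → ℕ}
    (hv : Function.Injective v) (φ : CFormula L) (α : ℕ → A) :
    (exs v φ).Sat α ↔ ∃ c : J → A, φ.Sat (Function.extend v c α) := by
  -- Phrasing the witness as a whole assignment that agrees with `α` off the listed variables makes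
  -- the order of quantification irrelevant.
  have key : ∀ (l : List J) (α : ℕ → A), (l.foldr (fun j ψ => ex (v j) ψ) φ).Sat α ↔
      ∃ α' : ℕ → A, (∀ i, (∀ j ∈ l, v j ≠ i) → α' i = α i) ∧ φ.Sat α' := by
    intro l
    induction l with
    | nil =>
      intro α
      constructor
      · intro h
        exact ⟨α, fun _ _ => rfl, h⟩
      · rintro ⟨α', h, h'⟩
        obtain rfl : α' = α := funext fun i => h i (by simp)
        exact h'
    | cons j l ih =>
      intro α
      simp only [List.foldr_cons, Sat, ih]
      constructor
      · rintro ⟨a, α', h, h'⟩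
        refine ⟨α', fun i hi => ?_, h'⟩
        simp only [List.mem_cons, forall_eq_or_imp] at hi
        rw [h i hi.2, Function.update_of_ne hi.1.symm]
      · rintro ⟨α', h, h'⟩
        refine ⟨α' (v j), α', fun i hi => ?_, h'⟩
        by_cases hij : v j = i
        · subst hij; simp
        · rw [Function.update_of_ne (Ne.symm hij)]
          refine h i ?_
          simpa [hij] using hi
  rw [exs, key]
  constructor
  · rintro ⟨α', h, h'⟩
    refine ⟨α' ∘ v, ?_⟩
    rwa [Function.extend_comp_self_of_agree hv]
    intro i hi
    exact h i fun j _ e => hi ⟨j, e⟩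
  · rintro ⟨c, h⟩
    refine ⟨_, fun i hi => ?_, h⟩
    refine Function.extend_eq_of_notMem_range _ _ _ ?_
    rintro ⟨j, e⟩
    exact hi j (by simp) e

theorem Fits.exs {J : Type*} [Fintype J] {k r : ℕ} {F : Set ℕ} {φ : CFormula L} {v : J → ℕ}
    (h : Fits k r F φ) (hv : ∀ j, v j < k) :
    Fits k (r + Fintype.card J) (F \ Set.range v) (exs v φ) := by
  have key : ∀ l : List J, Fits k (r + l.length) (F \ {i | ∃ j ∈ l, v j = i})
      (l.foldr (fun j ψ => CFormula.ex (v j) ψ) φ) := by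
    intro l
    induction l with
    | nil => exact h.mono le_rfl le_rfl (by simp)
    | cons j l ih =>
      refine (ih.ex (hv j)).mono le_rfl (by simp [add_assoc]) ?_
      rintro i ⟨⟨h1, h2⟩, h3⟩
      refine ⟨h1, ?_⟩
      rintro ⟨j', hj', e⟩
      rcases List.mem_cons.1 hj' with rfl | hj'
      · exact h3 e.symm
      · exact h2 ⟨j', hj', e⟩
  refine (key (Finset.univ.toList (α := J))).mono le_rfl (by simp) ?_
  rintro i ⟨h1, h2⟩
  refine ⟨h1, ?_⟩
  rintro ⟨j, e⟩
  exact h2 ⟨j, by simp, e⟩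

/-- Equality of two tuples of variables. -/
noncomputable def eqs {J : Type*} [Fintype J] (v u : J → ℕ) : CFormula L :=
  conj Finset.univ fun j => eq (v j) (u j)

@[simp] theorem sat_eqs {J : Type*} [Fintype J] {A : Type w} [L.Structure A] [Finite A]
    (v u : J → ℕ) (α : ℕ → A) : (eqs v u : CFormula L).Sat α ↔ α ∘ v = α ∘ u := by
  simp [eqs, Sat, funext_iff]

theorem Fits.eqs {J : Type*} [Fintype J] {k r : ℕ} {F : Set ℕ} {v u : J → ℕ} (hk : 0 < k)
    (hr : 0 < r) (hv : ∀ j, v j < k) (hu : ∀ j, u j < k) (hvF : Set.range v ⊆ F)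
    (huF : Set.range u ⊆ F) : Fits k r F (eqs v u : CFormula L) :=
  Fits.conj hk hr fun j _ => .eq (hv j) (hu j) (hvF ⟨j, rfl⟩) (huF ⟨j, rfl⟩)

/-- Substitution of the variables `u` for the variables `v` in `φ`, with the help of fresh
variables `z`. -/
noncomputable def subst {J : Type*} [Fintype J] (z v u : J → ℕ) (φ : CFormula L) : CFormula L :=
  exs z (and (eqs z u) (exs v (and (eqs v z) φ)))

/-- The tuples `u` and `v` may overlap (as in a swap), so the values of `u` are first stored in `z`
and only then copied to `v`. Only the free variables of `φ` have to avoid `z`: bound occurrences are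
harmless, so the same `z` can serve in nested substitutions. -/
theorem sat_subst {J : Type*} [Fintype J] {A : Type w} [L.Structure A] [Finite A]
    {z v u : J → ℕ} {φ : CFormula L} (hz : Function.Injective z) (hv : Function.Injective v)
    (hzv : Disjoint (Set.range z) (Set.range v)) (hzu : Disjoint (Set.range z) (Set.range u))
    (hzφ : Disjoint (Set.range z) φ.free) (α : ℕ → A) :
    (subst z v u φ).Sat α ↔ φ.Sat (Function.extend v (α ∘ u) α) := by
  have hu : ∀ c : J → A, Function.extend z c α ∘ u = α ∘ u := fun c => funext fun j =>
    Function.extend_eq_of_notMem_range _ _ _ (Set.disjoint_right.1 hzu ⟨j, rfl⟩)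
  have hvz : ∀ (c : J → A) (α : ℕ → A), Function.extend v c α ∘ z = α ∘ z :=
    fun c α => funext fun j =>
      Function.extend_eq_of_notMem_range _ _ _ (Set.disjoint_left.1 hzv ⟨j, rfl⟩)
  have hcv : ∀ (c : J → A) (α : ℕ → A), Function.extend v c α ∘ v = c :=
    fun c α => funext fun j => hv.extend_apply _ _ _
  have hcz : ∀ (c : J → A), Function.extend z c α ∘ z = c :=
    fun c => funext fun j => hz.extend_apply _ _ _
  simp only [subst, sat_exs hz, sat_exs hv, sat_and, sat_eqs, hu, hvz, hcv, hcz]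
  have hφ : ∀ c c' : J → A, φ.Sat (Function.extend v c (Function.extend z c' α)) ↔
      φ.Sat (Function.extend v c α) := by
    intro c c'
    refine sat_congr φ fun i hi => ?_
    by_cases hiv : i ∈ Set.range v
    · obtain ⟨j, rfl⟩ := hiv
      rw [hv.extend_apply, hv.extend_apply]
    · rw [Function.extend_eq_of_notMem_range _ _ _ hiv,
        Function.extend_eq_of_notMem_range _ _ _ hiv,
        Function.extend_eq_of_notMem_range _ _ _ (Set.disjoint_right.1 hzφ hi)]
  simp [hφ]

theorem Fits.subst {J : Type*} [Fintype J] {k r : ℕ} {F : Set ℕ} {z v u : J → ℕ}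
    {φ : CFormula L} (h : Fits k r F φ) (hk : 0 < k) (hr : 0 < r)
    (hz : ∀ j, z j < k) (hv : ∀ j, v j < k) (hu : ∀ j, u j < k) :
    Fits k (r + 2 * Fintype.card J) ((F \ Set.range v) ∪ Set.range u) (subst z v u φ) := by
  have h1 : Fits k r (F ∪ (Set.range v ∪ Set.range z)) (CFormula.and (CFormula.eqs v z) φ) :=
    (Fits.eqs hk hr hv hz
      (Set.subset_union_left.trans Set.subset_union_right)
      (Set.subset_union_right.trans Set.subset_union_right)).and
      (h.mono le_rfl le_rfl Set.subset_union_left)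
  have h2 : Fits k (r + Fintype.card J) ((F \ Set.range v) ∪ Set.range u ∪ Set.range z)
      (CFormula.and (CFormula.eqs z u) (CFormula.exs v (CFormula.and (CFormula.eqs v z) φ))) := by
    refine (Fits.eqs hk (by omega) hz hu Set.subset_union_right
      (Set.subset_union_right.trans Set.subset_union_left)).and
      ((h1.exs hv).mono le_rfl le_rfl ?_)
    rintro i ⟨h1 | h1 | h1, h2⟩
    · exact Or.inl (Or.inl ⟨h1, h2⟩)
    · exact absurd h1 h2
    · exact Or.inr h1
  refine (h2.exs hz).mono le_rfl (by omega) ?_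
  rintro i ⟨h1 | h1, h2⟩
  · exact h1
  · exact absurd h1 h2

end CFormula

/-! ### Reachability by squaring, expressed in `C`. -/

namespace CFormula

variable {L : FirstOrder.Language.{u, v}}

/-- The formula, with free variables among `x`, `y` and the parameters of `E`, that expresses that
the mixed tuple `(y, t)` can be reached from `(x, s)` with at least one and at most `2 ^ d` steps
of the symmetric closure of `E`; the components of `s` and `t` are constants. -/
noncomputable def reach {k l : ℕ} (n : ℕ) (x y z : Fin k → ℕ) (w : Fin k ⊕ Fin k → ℕ)
    (E : (Fin l → ℕ) → (Fin l → ℕ) → CFormula L) :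
    ℕ → (Fin l → ℕ) → (Fin l → ℕ) → CFormula L
  | 0, s, t => or (E s t) (subst w (Sum.elim x y) (Sum.elim y x) (E t s))
  | d + 1, s, t => or (reach n x y z w E d s t)
      (disj (Finset.univ : Finset (Fin l → Fin (n + 1))) fun m =>
        and (conj Finset.univ fun j => cardGe (m j))
          (exs z (and
            (subst w (Sum.elim x y) (Sum.elim x z) (reach n x y z w E d s fun j => m j))
            (subst w (Sum.elim x y) (Sum.elim z y) (reach n x y z w E d (fun j => m j) t)))))

/-- A substitution on `2k` variables costs depth `4k`: one at the base, for the reversed edge, and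
`4k` more per round, plus `k` for the midpoint. The set of free variables does not grow with `d`, so
`z` and `w` are fresh again in every round. -/
theorem Fits.reach {k l n K r : ℕ} {F : Set ℕ} {x y z : Fin k → ℕ} {w : Fin k ⊕ Fin k → ℕ}
    {E : (Fin l → ℕ) → (Fin l → ℕ) → CFormula L} (hE : ∀ s t, Fits K r F (E s t))
    (hK : 0 < K) (hr : 0 < r) (hx : ∀ j, x j < K) (hy : ∀ j, y j < K) (hz : ∀ j, z j < K)
    (hw : ∀ j, w j < K) (d : ℕ) (s t : Fin l → ℕ) :
    Fits K (r + 4 * k + d * (5 * k)) (F ∪ Set.range (Sum.elim x y))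
      (CFormula.reach n x y z w E d s t) := by
  induction d generalizing s t with
  | zero =>
    refine ((hE s t).mono le_rfl (by omega) Set.subset_union_left).or
      (((hE t s).subst hK hr hw (by simp [hx, hy]) (by simp [hx, hy])).mono le_rfl ?_ ?_)
    · simp; omega
    · rintro i (h | h)
      · exact Or.inl h.1
      · refine Or.inr ?_
        simpa [or_comm] using h
  | succ d ih =>
    refine ((ih s t).mono le_rfl (by gcongr; omega) subset_rfl).or
      (Fits.disj hK (by omega) fun m _ => ?_)
    refine Fits.and (Fits.conj hK (by omega) fun j _ => .cardGe _ hK (by omega)) ?_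
    have h1 := ((ih s fun j => m j).subst (u := Sum.elim x z) hK (by omega) hw
      (v := Sum.elim x y) (by simp [hx, hy]) (by simp [hx, hz])).mono
        (F' := F ∪ Set.range (Sum.elim x y) ∪ Set.range z) le_rfl le_rfl (by
          simp only [Set.Sum.elim_range]
          rintro i (h | h | h)
          · exact Or.inl h.1
          · exact Or.inl (Or.inr (Or.inl h))
          · exact Or.inr h)
    have h2 := ((ih (fun j => m j) t).subst (u := Sum.elim z y) hK (by omega) hw
      (v := Sum.elim x y) (by simp [hx, hy]) (by simp [hy, hz])).mono
        (F' := F ∪ Set.range (Sum.elim x y) ∪ Set.range z) le_rfl le_rfl (by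
          simp only [Set.Sum.elim_range]
          rintro i (h | h | h)
          · exact Or.inl h.1
          · exact Or.inr h
          · exact Or.inl (Or.inr (Or.inr h)))
    refine ((h1.and h2).exs hz).mono le_rfl ?_ ?_
    · simp only [Fintype.card_sum, Fintype.card_fin, add_mul]
      omega
    · rintro i ⟨h | h, h'⟩
      · exact h
      · exact absurd h h'

theorem sat_reach {k l n : ℕ} {F : Set ℕ} {x y z : Fin k → ℕ} {w : Fin k ⊕ Fin k → ℕ}
    {E : (Fin l → ℕ) → (Fin l → ℕ) → CFormula L}
    {A : Type w} [L.Structure A] [Finite A] (hA : Nat.card A ≤ n)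
    (hxy : Function.Injective (Sum.elim x y)) (hz : Function.Injective z)
    (hw : Function.Injective w)
    (hzxy : Disjoint (Set.range z) (Set.range (Sum.elim x y)))
    (hwxy : Disjoint (Set.range w) (Set.range (Sum.elim x y)))
    (hwz : Disjoint (Set.range w) (Set.range z))
    (hwF : Disjoint (Set.range w) F) (hzF : Disjoint (Set.range z) F)
    (hEF : ∀ s t, (E s t).free ⊆ F)
    (hRF : ∀ d s t, (reach n x y z w E d s t).free ⊆ F ∪ Set.range (Sum.elim x y))
    (α : ℕ → A)
    (e : (Fin k → A) × (Fin l → NumSort A) → (Fin k → A) × (Fin l → NumSort A) → Prop)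
    (he : ∀ s t, e s t ↔ (E (fun j => s.2 j) (fun j => t.2 j)).Sat
      (Function.extend (Sum.elim x y) (Sum.elim s.1 t.1) α))
    (d : ℕ) (s t : (Fin k → A) × (Fin l → NumSort A)) :
    (reach n x y z w E d (fun j => s.2 j) (fun j => t.2 j)).Sat
      (Function.extend (Sum.elim x y) (Sum.elim s.1 t.1) α) ↔
      Relation.Squaring (fun s t => e s t ∨ e t s) d s t := by
  have hwu : ∀ u u' : Fin k → ℕ, Set.range u ⊆ Set.range (Sum.elim x y) ∪ Set.range z →
      Set.range u' ⊆ Set.range (Sum.elim x y) ∪ Set.range z →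
      Disjoint (Set.range w) (Set.range (Sum.elim u u')) := by
    intro u u' h h'
    rw [Set.Sum.elim_range]
    exact (hwxy.union_right hwz).mono_right (Set.union_subset h h')
  have hxs : Set.range x ⊆ Set.range (Sum.elim x y) ∪ Set.range z := by
    rw [Set.Sum.elim_range]; exact Set.subset_union_left.trans Set.subset_union_left
  have hys : Set.range y ⊆ Set.range (Sum.elim x y) ∪ Set.range z := by
    rw [Set.Sum.elim_range]; exact Set.subset_union_right.trans Set.subset_union_left
  have hzs : Set.range z ⊆ Set.range (Sum.elim x y) ∪ Set.range z := Set.subset_union_right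
  -- a second extension along the same tuple overrides the first one
  have hover : ∀ (ψ : CFormula L) (a a' : Fin k ⊕ Fin k → A) (c : Fin k → A),
      ψ.free ⊆ F ∪ Set.range (Sum.elim x y) →
      (ψ.Sat (Function.extend (Sum.elim x y) a
        (Function.extend z c (Function.extend (Sum.elim x y) a' α))) ↔
      ψ.Sat (Function.extend (Sum.elim x y) a α)) := by
    intro ψ a a' c hψ
    refine sat_congr ψ fun i hi => ?_
    by_cases hiv : i ∈ Set.range (Sum.elim x y)
    · obtain ⟨j, rfl⟩ := hiv
      rw [hxy.extend_apply, hxy.extend_apply]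
    · rw [Function.extend_eq_of_notMem_range _ _ _ hiv,
        Function.extend_eq_of_notMem_range _ _ _ hiv,
        Function.extend_eq_of_notMem_range _ _ _, Function.extend_eq_of_notMem_range _ _ _ hiv]
      rcases hψ hi with h | h
      · exact Set.disjoint_right.1 hzF h
      · exact absurd h hiv
  have hover' : ∀ (ψ : CFormula L) (a a' : Fin k ⊕ Fin k → A),
      (ψ.Sat (Function.extend (Sum.elim x y) a (Function.extend (Sum.elim x y) a' α)) ↔
      ψ.Sat (Function.extend (Sum.elim x y) a α)) := by
    intro ψ a a'
    refine sat_congr ψ fun i _ => ?_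
    by_cases hiv : i ∈ Set.range (Sum.elim x y)
    · obtain ⟨j, rfl⟩ := hiv
      rw [hxy.extend_apply, hxy.extend_apply]
    · rw [Function.extend_eq_of_notMem_range _ _ _ hiv,
        Function.extend_eq_of_notMem_range _ _ _ hiv,
        Function.extend_eq_of_notMem_range _ _ _ hiv]
  have hex : ∀ (a b : Fin k → A) j,
      Function.extend (Sum.elim x y) (Sum.elim a b) α (x j) = a j :=
    fun a b j => hxy.extend_apply (Sum.elim a b) α (Sum.inl j)
  have hey : ∀ (a b : Fin k → A) j,
      Function.extend (Sum.elim x y) (Sum.elim a b) α (y j) = b j :=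
    fun a b j => hxy.extend_apply (Sum.elim a b) α (Sum.inr j)
  have hzx : ∀ (c : Fin k → A) (γ : ℕ → A) j, Function.extend z c γ (x j) = γ (x j) :=
    fun c γ j => Function.extend_eq_of_notMem_range _ _ _
      (Set.disjoint_right.1 hzxy ⟨Sum.inl j, rfl⟩)
  have hzy : ∀ (c : Fin k → A) (γ : ℕ → A) j, Function.extend z c γ (y j) = γ (y j) :=
    fun c γ j => Function.extend_eq_of_notMem_range _ _ _
      (Set.disjoint_right.1 hzxy ⟨Sum.inr j, rfl⟩)
  induction d generalizing s t with
  | zero =>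
    simp only [reach, Sat, Relation.Squaring]
    rw [sat_subst hw hxy hwxy (hwu y x hys hxs) (hwF.mono_right (hEF _ _)), hover', he s t,
      he t s]
    have : Function.extend (Sum.elim x y) (Sum.elim s.1 t.1) α ∘ Sum.elim y x =
        Sum.elim t.1 s.1 := by
      funext j
      rcases j with j | j <;> simp [hex, hey]
    rw [this]
  | succ d ih =>
    have hfree : ∀ s t, Disjoint (Set.range w) (reach n x y z w E d s t).free :=
      fun s t => (hwF.union_right hwxy).mono_right (hRF d s t)
    simp only [reach, Sat, Relation.Squaring, sat_disj, sat_and, sat_conj, sat_cardGe, sat_exs hz,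
      sat_subst hw hxy hwxy (hwu x z hxs hzs) (hfree _ _),
      sat_subst hw hxy hwxy (hwu z y hzs hys) (hfree _ _), hover _ _ _ _ (hRF d _ _)]
    have h1 : ∀ c : Fin k → A, Function.extend z c
        (Function.extend (Sum.elim x y) (Sum.elim s.1 t.1) α) ∘ Sum.elim x z =
        Sum.elim s.1 c := by
      intro c; funext j
      rcases j with j | j <;> simp [hex, hzx, hz.extend_apply]
    have h2 : ∀ c : Fin k → A, Function.extend z c
        (Function.extend (Sum.elim x y) (Sum.elim s.1 t.1) α) ∘ Sum.elim z y =
        Sum.elim c t.1 := by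
      intro c; funext j
      rcases j with j | j <;> simp [hey, hzy, hz.extend_apply]
    simp only [h1, h2]
    refine or_congr (ih s t) ?_
    constructor
    · rintro ⟨m, -, hm, c, h⟩
      -- The guards turn the guessed constants, a priori only at most `n`, into elements of the
      -- number sort.
      have hm' : ∀ j, (m j : ℕ) < Nat.card A + 1 := fun j =>
        Nat.lt_succ_of_le (hm j (Finset.mem_univ _))
      refine ⟨(c, fun j => ⟨m j, hm' j⟩), ?_⟩
      exact ⟨(ih s (c, _)).1 h.1, (ih (c, _) t).1 h.2⟩
    · rintro ⟨m, h⟩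
      exact ⟨fun j => Fin.castLE (Nat.succ_le_succ hA) (m.2 j), Finset.mem_univ _,
        fun j _ => Nat.le_of_lt_succ (m.2 j).2, m.1, (ih s m).2 h.1, (ih m t).2 h.2⟩

end CFormula

/-! ### Translation of `STC+C` by induction on formulae. -/

namespace STCCFormula

open CFormula (Fits)

variable {L : FirstOrder.Language.{u, v}}

/-- Needed at the very end, where the family is indexed by the values of `ι` alone and all other
number variables get a default value. -/
theorem sat_congr_num {A : Type w} [L.Structure A] (φ : STCCFormula L) (α : ℕ → A)
    {β β' : ℕ → NumSort A} (h : ∀ i ∈ φ.freeNum, β i = β' i) : φ.Sat α β ↔ φ.Sat α β' := by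
  induction φ generalizing α β β' with
  | eq x y => rfl
  | rel R x => rfl
  | numEq ι κ => simp only [Sat]; rw [h ι (by simp [freeNum]), h κ (by simp [freeNum])]
  | numLe ι κ => simp only [Sat]; rw [h ι (by simp [freeNum]), h κ (by simp [freeNum])]
  | numSucc ι κ => simp only [Sat]; rw [h ι (by simp [freeNum]), h κ (by simp [freeNum])]
  | numMin ι => simp only [Sat]; rw [h ι (by simp [freeNum])]
  | numMax ι => simp only [Sat]; rw [h ι (by simp [freeNum])]
  | not φ ih => exact not_congr (ih α h)
  | or φ ψ ih1 ih2 =>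
    exact or_congr (ih1 α fun i hi => h i (Or.inl hi)) (ih2 α fun i hi => h i (Or.inr hi))
  | exDom x φ ih => exact exists_congr fun a => ih _ h
  | exNum ι φ ih =>
    refine exists_congr fun a => ih _ fun i hi => ?_
    by_cases hx : i = ι
    · subst hx; simp
    · simp only [Function.update_of_ne hx]
      exact h i ⟨hi, hx⟩
  | countDom x φ κ ih =>
    simp only [Sat, h κ (Or.inl rfl)]
    have : {a : A | φ.Sat (Function.update α x a) β} = {a | φ.Sat (Function.update α x a) β'} :=
      Set.ext fun a => ih _ fun i hi => h i (Or.inr hi)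
    rw [this]
  | countNum ι φ κ ih =>
    simp only [Sat, h κ (Or.inl rfl)]
    have : {j : NumSort A | φ.Sat α (Function.update β ι j)} =
        {j | φ.Sat α (Function.update β' ι j)} := by
      refine Set.ext fun a => ih _ fun i hi => ?_
      by_cases hx : i = ι
      · subst hx; simp
      · simp only [Function.update_of_ne hx]
        exact h i (Or.inr ⟨hi, hx⟩)
    rw [this]
  | stc x y ι κ hd hn φ x' y' ι' κ' ih =>
    simp only [Sat]
    have h1 : ∀ j, β (ι' j) = β' (ι' j) := fun j => h _ (Or.inr (Or.inl ⟨j, rfl⟩))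
    have h2 : ∀ j, β (κ' j) = β' (κ' j) := fun j => h _ (Or.inr (Or.inr ⟨j, rfl⟩))
    have h3 : ∀ a b, φ.Sat a (Function.extend (Sum.elim ι κ) b β) ↔
        φ.Sat a (Function.extend (Sum.elim ι κ) b β') := by
      intro a b
      refine ih a fun i hi => ?_
      by_cases hiv : i ∈ Set.range (Sum.elim ι κ)
      · obtain ⟨j, rfl⟩ := hiv
        rw [hn.extend_apply, hn.extend_apply]
      · rw [Function.extend_eq_of_notMem_range _ _ _ hiv,
          Function.extend_eq_of_notMem_range _ _ _ hiv]
        rw [Set.Sum.elim_range] at hiv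
        exact h i (Or.inl ⟨hi, hiv⟩)
    simp only [h1, h2, h3]

/-- On structures with at most `n` elements, the formula `φ` of `STC+C` is equivalent, under the
number assignment `b`, to the formula `ψ b` of `C`. -/
def Translates (n : ℕ) (φ : STCCFormula L) (ψ : (ℕ → ℕ) → CFormula L) : Prop :=
  ∀ (A : Type w) [L.Structure A] [Finite A], Nat.card A ≤ n →
    ∀ (α : ℕ → A) (β : ℕ → NumSort A), φ.Sat α β ↔ (ψ fun j => β j).Sat α

/-- The formula `φ` of `STC+C` can be translated, on structures with at most `n` elements, to
formulae of `C` with a constant number of variables and logarithmic quantifier depth. -/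
def Translatable (φ : STCCFormula L) : Prop :=
  ∃ k C : ℕ, 0 < k ∧ 0 < C ∧ ∀ n : ℕ, ∃ ψ : (ℕ → ℕ) → CFormula L,
    (∀ b, Fits k (C * (n.size + 1)) φ.freeDom (ψ b)) ∧ Translates.{u, v, w} n φ ψ

/-- For atoms whose truth value depends on the number assignment only. The atom `numMax` is not of
this kind, since it refers to the size of the structure. -/
theorem translatable_const (φ : STCCFormula L) (p : (ℕ → ℕ) → Prop)
    (h : ∀ (A : Type w) [L.Structure A] (α : ℕ → A) (β : ℕ → NumSort A),
      φ.Sat α β ↔ p fun j => β j) : Translatable.{u, v, w} φ := by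
  classical
  refine ⟨1, 1, one_pos, one_pos, fun n => ⟨fun b => .const (p b), fun b =>
    .const _ one_pos (by omega), ?_⟩⟩
  intro A _ _ _ α β
  rw [CFormula.sat_const, h]

theorem translatable_eq (x y : ℕ) : Translatable.{u, v, w} (eq x y : STCCFormula L) := by
  refine ⟨x + y + 1, 1, by omega, one_pos, fun n => ⟨fun _ => .eq x y, fun _ =>
    .eq (by omega) (by omega) (by simp [freeDom]) (by simp [freeDom]), ?_⟩⟩
  intro A _ _ _ α β
  rfl

theorem exists_forall_lt_nat {J : Type*} [Finite J] (x : J → ℕ) : ∃ N, ∀ j, x j < N := by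
  obtain ⟨N, hN⟩ := (Set.finite_range x).bddAbove
  exact ⟨N + 1, fun j => Nat.lt_succ_of_le (hN ⟨j, rfl⟩)⟩

theorem translatable_rel {r : ℕ} (R : L.Relations r) (x : Fin r → ℕ) :
    Translatable.{u, v, w} (rel R x) := by
  obtain ⟨N, hN⟩ := exists_forall_lt_nat x
  refine ⟨N + 1, 1, by omega, one_pos, fun n => ⟨fun _ => .rel R x, fun _ =>
    ⟨?_, Nat.zero_le _, subset_rfl⟩, ?_⟩⟩
  · rintro _ ⟨j, rfl⟩
    exact (hN j).trans (Nat.lt_succ_self N)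
  · intro A _ _ _ α β
    rfl

theorem translatable_numMax (ι : ℕ) : Translatable.{u, v, w} (numMax ι : STCCFormula L) := by
  refine ⟨1, 1, one_pos, one_pos, fun n => ⟨fun b =>
    .and (.cardGe (b ι)) (.not (.cardGe (b ι + 1))), fun _ =>
    .and (.cardGe _ one_pos (by omega)) (.not (.cardGe _ one_pos (by omega))), ?_⟩⟩
  intro A _ _ _ α β
  simp only [CFormula.sat_and, CFormula.Sat, CFormula.sat_cardGe, Sat]
  omega

theorem Translatable.not {φ : STCCFormula L} (h : Translatable.{u, v, w} φ) :
    Translatable.{u, v, w} φ.not := by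
  obtain ⟨k, C, hk, hC, h⟩ := h
  refine ⟨k, C, hk, hC, fun n => ?_⟩
  obtain ⟨ψ, h1, h2⟩ := h n
  exact ⟨fun b => (ψ b).not, fun b => (h1 b).not, fun A _ _ hA α β => not_congr (h2 A hA α β)⟩

theorem Translatable.or {φ φ' : STCCFormula L} (h : Translatable.{u, v, w} φ)
    (h' : Translatable.{u, v, w} φ') : Translatable.{u, v, w} (φ.or φ') := by
  obtain ⟨k, C, hk, hC, h⟩ := h
  obtain ⟨k', C', hk', hC', h'⟩ := h'
  refine ⟨k + k', C + C', by omega, by omega, fun n => ?_⟩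
  obtain ⟨ψ, h1, h2⟩ := h n
  obtain ⟨ψ', h1', h2'⟩ := h' n
  refine ⟨fun b => (ψ b).or (ψ' b), fun b => .or ((h1 b).mono (by omega) ?_ Set.subset_union_left)
    ((h1' b).mono (by omega) ?_ Set.subset_union_right),
    fun A _ _ hA α β => or_congr (h2 A hA α β) (h2' A hA α β)⟩
  · gcongr; omega
  · gcongr; omega

theorem Translatable.exDom {φ : STCCFormula L} (h : Translatable.{u, v, w} φ) (x : ℕ) :
    Translatable.{u, v, w} (φ.exDom x) := by
  obtain ⟨k, C, hk, hC, h⟩ := h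
  refine ⟨k + x + 1, C + 1, by omega, by omega, fun n => ?_⟩
  obtain ⟨ψ, h1, h2⟩ := h n
  refine ⟨fun b => (ψ b).ex x, fun b => (((h1 b).mono (k' := k + x + 1) (by omega) le_rfl
    subset_rfl).ex (by omega)).mono le_rfl ?_ subset_rfl,
    fun A _ _ hA α β => exists_congr fun a => h2 A hA _ β⟩
  -- Raising `C` by one adds `n.size + 1 ≥ 1` to the bound, which pays for the new quantifier.
  rw [add_mul]; omega

theorem Translatable.countDom {φ : STCCFormula L} (h : Translatable.{u, v, w} φ) (x κ : ℕ) :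
    Translatable.{u, v, w} (φ.countDom x κ) := by
  obtain ⟨k, C, hk, hC, h⟩ := h
  refine ⟨k + x + 1, C + 1, by omega, by omega, fun n => ?_⟩
  obtain ⟨ψ, h1, h2⟩ := h n
  have h3 : ∀ m b, Fits (k + x + 1) ((C + 1) * (n.size + 1)) (φ.freeDom \ {x})
      ((ψ b).exGe m x) := fun m b => (((h1 b).mono (k' := k + x + 1) (by omega) le_rfl
    subset_rfl).exGe m (by omega)).mono le_rfl (by rw [add_mul]; omega) subset_rfl
  refine ⟨fun b => .and ((ψ b).exGe (b κ) x) (.not ((ψ b).exGe (b κ + 1) x)),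
    fun b => (h3 _ _).and (h3 _ _).not, fun A _ _ hA α β => ?_⟩
  have h4 : {a : A | φ.Sat (Function.update α x a) β} =
      {a : A | (ψ fun j => β j).Sat (Function.update α x a)} :=
    Set.ext fun a => h2 A hA _ β
  simp only [Sat, CFormula.sat_and, CFormula.Sat, h4, not_le]
  rw [Nat.cast_add, Nat.cast_one, ENat.lt_add_one_iff (ENat.natCast_ne_top _), ← le_antisymm_iff,
    eq_comm]

theorem val_update {A : Type w} (β : ℕ → NumSort A) (ι : ℕ) (i : NumSort A) :
    (fun j => (Function.update β ι i j : ℕ)) = Function.update (fun j => (β j : ℕ)) ι i :=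
  funext fun j => Function.apply_update (fun _ (m : NumSort A) => (m : ℕ)) β ι i j

/-- No domain quantifier encloses the translation of `φ`; the guard's depth 1 fits into the positive
bound already available. Hence `k` and `C` do not change. -/
theorem Translatable.exNum {φ : STCCFormula L} (h : Translatable.{u, v, w} φ) (ι : ℕ) :
    Translatable.{u, v, w} (φ.exNum ι) := by
  obtain ⟨k, C, hk, hC, h⟩ := h
  refine ⟨k, C, hk, hC, fun n => ?_⟩
  obtain ⟨ψ, h1, h2⟩ := h n
  have hpos : 0 < C * (n.size + 1) := by positivity
  refine ⟨fun b => .disj (Finset.range (n + 1)) fun m =>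
      .and (.cardGe m) (ψ (Function.update b ι m)),
    fun b => .disj hk hpos fun m _ => .and (.cardGe m hk hpos) (h1 _), fun A _ _ hA α β => ?_⟩
  simp only [Sat, CFormula.sat_disj, CFormula.sat_and, CFormula.sat_cardGe, h2 A hA, val_update,
    Finset.mem_range]
  constructor
  · rintro ⟨i, h⟩
    exact ⟨i, by omega, by omega, h⟩
  · rintro ⟨m, _, hm, h⟩
    exact ⟨⟨m, by omega⟩, h⟩

/-- The disjunction guesses the exact set `S` of witnesses among the subsets of `{0, …, n}` of the
required size. There are exponentially many, but they cost no depth. -/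
theorem Translatable.countNum {φ : STCCFormula L} (h : Translatable.{u, v, w} φ) (ι κ : ℕ) :
    Translatable.{u, v, w} (φ.countNum ι κ) := by
  classical
  obtain ⟨k, C, hk, hC, h⟩ := h
  refine ⟨k, C, hk, hC, fun n => ?_⟩
  obtain ⟨ψ, h1, h2⟩ := h n
  have hpos : 0 < C * (n.size + 1) := by positivity
  -- With the guard inside `χ`, values above the size of the structure never count as witnesses.
  let χ : (ℕ → ℕ) → ℕ → CFormula L := fun b m => .and (.cardGe m) (ψ (Function.update b ι m))
  have hχ : ∀ b m, Fits k (C * (n.size + 1)) φ.freeDom (χ b m) :=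
    fun b m => .and (.cardGe m hk hpos) (h1 _)
  refine ⟨fun b => .disj ((Finset.range (n + 1)).powersetCard (b κ)) fun S =>
      .conj (Finset.range (n + 1)) fun m => if m ∈ S then χ b m else .not (χ b m),
    fun b => .disj hk hpos fun S _ => .conj hk hpos fun m _ => ?_, fun A _ _ hA α β => ?_⟩
  · split_ifs
    · exact hχ b m
    · exact (hχ b m).not
  set T : Set ℕ := {m | (χ (fun j => β j) m).Sat α} with hT
  have hTlt : ∀ m ∈ T, m < Nat.card A + 1 := by
    intro m hm
    simp only [hT, χ, Set.mem_ofPred_eq, CFormula.sat_and, CFormula.sat_cardGe] at hm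
    omega
  have himage : {i : NumSort A | φ.Sat α (Function.update β ι i)}.encard = T.encard := by
    rw [← Fin.val_injective.encard_image]
    congr 1
    ext m
    simp only [hT, χ, Set.mem_image, Set.mem_ofPred_eq, CFormula.sat_and, CFormula.sat_cardGe,
      h2 A hA, val_update]
    constructor
    · rintro ⟨i, h, rfl⟩
      exact ⟨by omega, h⟩
    · rintro ⟨hm, h⟩
      exact ⟨⟨m, by omega⟩, h, rfl⟩
  have hsat : ∀ (S : Finset ℕ) m, (if m ∈ S then χ (fun j => β j) m else
      .not (χ (fun j => β j) m)).Sat α ↔ (m ∈ T ↔ m ∈ S) := by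
    intro S m
    split_ifs with hm <;> simp [hm, hT, CFormula.Sat]
  simp only [Sat, himage, CFormula.sat_disj, CFormula.sat_conj, hsat, Finset.mem_powersetCard,
    Finset.mem_range]
  constructor
  · intro h
    have hfin : T.Finite := Set.finite_of_encard_eq_coe h
    refine ⟨hfin.toFinset, ⟨fun m hm => ?_, ?_⟩, fun m _ => by simp⟩
    · have := hTlt m (by simpa using hm)
      simp only [Finset.mem_range]
      omega
    · rw [hfin.encard_eq_coe_toFinset_card] at h
      exact_mod_cast h
  · rintro ⟨S, ⟨hS1, hS2⟩, h⟩
    have : T = S := by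
      ext m
      constructor
      · intro hm
        have := hTlt m hm
        exact (h m (by omega)).1 hm
      · intro hm
        exact (h m (by simpa using hS1 hm)).2 hm
    rw [this, Set.encard_coe_eq_coe_finsetCard, hS2]

theorem val_extend {A : Type w} {J : Type*} (β : ℕ → NumSort A) (v : J → ℕ) (c : J → NumSort A) :
    (fun j => ((Function.extend v c β j : NumSort A) : ℕ)) =
      Function.extend v (fun j => (c j : ℕ)) (fun j => (β j : ℕ)) :=
  funext fun _ => Function.apply_extend (fun m : NumSort A => (m : ℕ)) _ _ _

/-- A bound on the number of mixed tuples. -/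
theorem card_mixed_le {A : Type w} [Finite A] {k l n : ℕ} (hA : Nat.card A ≤ n) :
    Nat.card ((Fin k → A) × (Fin l → NumSort A)) ≤ 2 ^ ((k + l) * n.size) := by
  have h1 : n + 1 ≤ 2 ^ n.size := n.lt_size_self
  have e : Nat.card ((Fin k → A) × (Fin l → NumSort A)) =
      Nat.card A ^ k * (Nat.card A + 1) ^ l := by
    simp [Nat.card_prod, Nat.card_fun]
  calc _ = Nat.card A ^ k * (Nat.card A + 1) ^ l := e
    _ ≤ (2 ^ n.size) ^ k * (2 ^ n.size) ^ l := by gcongr <;> omega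
    _ = _ := by rw [← pow_add, ← pow_mul, mul_comm]

theorem Translatable.stc {φ : STCCFormula L} (h : Translatable.{u, v, w} φ) {k l : ℕ}
    (x y : Fin k → ℕ) (ι κ : Fin l → ℕ)
    (hdom : Function.Injective (Sum.elim x y)) (hnum : Function.Injective (Sum.elim ι κ))
    (x' y' : Fin k → ℕ) (ι' κ' : Fin l → ℕ) :
    Translatable.{u, v, w} (.stc x y ι κ hdom hnum φ x' y' ι' κ') := by
  obtain ⟨k₀, C, hk₀, hC, h⟩ := h
  obtain ⟨N, hN⟩ := exists_forall_lt_nat (Sum.elim (Sum.elim x y) (Sum.elim x' y'))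
  simp only [Sum.forall, Sum.elim_inl, Sum.elim_inr] at hN
  obtain ⟨⟨hx, hy⟩, hx', hy'⟩ := hN
  -- All variables of the given formulae and tuples lie below `M`; the next `k` indices are for
  -- midpoints, the `2k` after them for renaming.
  let M := k₀ + N
  let z : Fin k → ℕ := fun j => M + j
  let w : Fin k ⊕ Fin k → ℕ := Sum.elim (fun j => M + k + j) (fun j => M + 2 * k + j)
  let K := M + 3 * k
  have hzinj : Function.Injective z := fun i j e => Fin.ext (by simpa [z] using e)
  have hwinj : Function.Injective w := by
    rintro (i | i) (j | j) e <;> simp only [w, Sum.elim_inl, Sum.elim_inr] at e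
    · congr 1; exact Fin.ext (by omega)
    · omega
    · omega
    · congr 1; exact Fin.ext (by omega)
  have hzM : ∀ i ∈ Set.range z, M ≤ i := by
    rintro _ ⟨j, rfl⟩; simp [z]
  have hwM : ∀ i ∈ Set.range w, M + k ≤ i := by
    rintro _ ⟨j | j, rfl⟩ <;> simp only [w, Sum.elim_inl, Sum.elim_inr] <;> omega
  have hzK : ∀ j, z j < K := fun j => by simp only [z, K]; omega
  have hwK : ∀ j, w j < K := by
    rintro (j | j) <;> simp only [w, K, Sum.elim_inl, Sum.elim_inr] <;> omega
  have hxK : ∀ j, x j < K := fun j => (hx j).trans_le (by omega)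
  have hyK : ∀ j, y j < K := fun j => (hy j).trans_le (by omega)
  have hxK' : ∀ j, x' j < K := fun j => (hx' j).trans_le (by omega)
  have hyK' : ∀ j, y' j < K := fun j => (hy' j).trans_le (by omega)
  have hK : 0 < K := by omega
  -- Here `C` pays for the edge formula, `8 * k` for two renamings (reversed edges at the base and
  -- the final arguments), and `5 * k` for each of the `(k + l) * n.size` rounds.
  refine ⟨K, C + 8 * k + (k + l) * (5 * k), hK, by omega, fun n => ?_⟩
  obtain ⟨ψ, h1, h2⟩ := h n
  have hpos : 0 < C * (n.size + 1) := by positivity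
  let E : (ℕ → ℕ) → (Fin l → ℕ) → (Fin l → ℕ) → CFormula L :=
    fun b s t => ψ (Function.extend (Sum.elim ι κ) (Sum.elim s t) b)
  -- `φ.freeDom` alone is not known to lie below `M`; the intersection is, and it still contains the
  -- free variables of the translations.
  let F : Set ℕ := φ.freeDom ∩ Set.Iio k₀
  have hE : ∀ b s t, Fits K (C * (n.size + 1)) F (E b s t) := fun b s t =>
    ⟨fun i hi => ((h1 _).1 i hi).trans_le (by omega), (h1 _).2,
      Set.subset_inter (h1 _).3 fun i hi => (h1 _).1 i (CFormula.free_subset_vars _ hi)⟩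
  have hR := fun b => Fits.reach (n := n) (z := z) (hE b) hK hpos hxK hyK hzK hwK
  have hFM : ∀ i ∈ F, i < M := fun i hi => (Set.mem_Iio.1 hi.2).trans_le (by omega)
  have hrM : ∀ u u' : Fin k → ℕ, (∀ j, u j < N) → (∀ j, u' j < N) →
      ∀ i ∈ Set.range (Sum.elim u u'), i < M := by
    rintro u u' h h' _ ⟨j | j, rfl⟩
    · exact (h j).trans_le (by omega)
    · exact (h' j).trans_le (by omega)
  have hdisj : ∀ S T : Set ℕ, (∀ i ∈ S, M ≤ i) → (∀ i ∈ T, i < M) → Disjoint S T :=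
    fun S T hS hT => Set.disjoint_left.2 fun i hi hi' => absurd (hS i hi) (not_le.2 (hT i hi'))
  have hwM' : ∀ i ∈ Set.range w, M ≤ i := fun i hi => le_trans (by omega) (hwM i hi)
  have hwz : Disjoint (Set.range w) (Set.range z) := by
    refine Set.disjoint_left.2 fun i hi => ?_
    rintro ⟨j, rfl⟩
    have := hwM _ hi
    simp only [z] at this
    omega
  refine ⟨fun b => .subst w (Sum.elim x y) (Sum.elim x' y')
    (.reach n x y z w (E b) ((k + l) * n.size) (fun j => b (ι' j)) (fun j => b (κ' j))),
    fun b => ((hR b _ _ _).subst hK (by omega) hwK (by simp [hxK, hyK])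
      (by simp [hxK', hyK'])).mono le_rfl ?_ ?_, fun A _ _ hA α β => ?_⟩
  · have e : (C + 8 * k + (k + l) * (5 * k)) * (n.size + 1) = C * (n.size + 1) +
        8 * k * n.size + 8 * k + (k + l) * n.size * (5 * k) + (k + l) * (5 * k) := by ring
    simp only [Fintype.card_sum, Fintype.card_fin]
    rw [e]
    have := Nat.zero_le (8 * k * n.size)
    have := Nat.zero_le ((k + l) * (5 * k))
    omega
  · simp only [freeDom, Set.Sum.elim_range]
    rintro i (⟨hi | hi, hi'⟩ | hi)
    · exact Or.inl ⟨hi.1, hi'⟩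
    · exact absurd hi hi'
    · exact Or.inr hi
  · rw [CFormula.sat_subst hwinj hdom (hdisj _ _ hwM' (hrM _ _ hx hy))
      (hdisj _ _ hwM' (hrM _ _ hx' hy'))
      ((hdisj _ _ hwM' fun i hi => hi.elim (hFM i) (hrM _ _ hx hy i)).mono_right (hR _ _ _ _).3),
      Sum.comp_elim]
    simp only [Sat]
    rw [Relation.transGen_iff_squaring _ (card_mixed_le hA)]
    refine (CFormula.sat_reach hA hdom hzinj hwinj (hdisj _ _ hzM (hrM _ _ hx hy))
      (hdisj _ _ hwM' (hrM _ _ hx hy)) hwz (hdisj _ _ hwM' hFM) (hdisj _ _ hzM hFM)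
      (fun s t => (hE _ s t).3) (fun d s t => (hR _ d s t).3) α _ (fun s t => ?_) _
      (fun j => α (x' j), fun j => β (ι' j)) (fun j => α (y' j), fun j => β (κ' j))).symm
    rw [h2 A hA, val_extend]
    have e : (fun j => ((Sum.elim s.2 t.2 j : NumSort A) : ℕ)) =
        Sum.elim (fun j => (s.2 j : ℕ)) (fun j => (t.2 j : ℕ)) := by
      funext j
      rcases j with j | j <;> rfl
    rw [e]

theorem translatable (φ : STCCFormula L) : Translatable.{u, v, w} φ := by
  induction φ with
  | eq x y => exact translatable_eq x y
  | rel R x => exact translatable_rel R x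
  | numEq ι κ =>
    exact translatable_const _ (fun b => b ι = b κ) fun A _ α β => Fin.ext_iff
  | numLe ι κ =>
    exact translatable_const _ (fun b => b ι ≤ b κ) fun A _ α β => Iff.rfl
  | numSucc ι κ =>
    exact translatable_const _ (fun b => b κ = b ι + 1) fun A _ α β => Iff.rfl
  | numMin ι => exact translatable_const _ (fun b => b ι = 0) fun A _ α β => Iff.rfl
  | numMax ι => exact translatable_numMax ι
  | not φ ih => exact ih.not
  | or φ ψ ih1 ih2 => exact ih1.or ih2
  | exDom x φ ih => exact ih.exDom x
  | exNum ι φ ih => exact ih.exNum ι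
  | countDom x φ κ ih => exact ih.countDom x κ
  | countNum ι φ κ ih => exact ih.countNum ι κ
  | stc x y ι κ hd hn φ x' y' ι' κ' ih => exact ih.stc x y ι κ hd hn x' y' ι' κ'

end STCCFormula

/-! ### The logarithmic bound and the conclusion. -/

theorem isBigO_size_log (C : ℕ) :
    (fun n : ℕ => ((C * (n.size + 1) : ℕ) : ℝ)) =O[atTop] (fun n : ℕ => Real.log n) := by
  -- Write `n.size + 1` as `(n.size - 1) + 2`. The first summand is at most `log n / log 2` because
  -- `2 ^ (n.size - 1) ≤ n`; the 2 is absorbed by `2 * log n / log 2`, as `n ≥ 2`.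
  refine IsBigO.of_bound (C * (1 / Real.log 2 + 2 / Real.log 2)) ?_
  filter_upwards [eventually_ge_atTop 2] with n hn
  have hlog2 : 0 < Real.log 2 := Real.log_pos one_lt_two
  have hlog : Real.log 2 ≤ Real.log n := Real.log_le_log two_pos (by exact_mod_cast hn)
  have h1 : 2 ^ (n.size - 1) ≤ n := Nat.lt_size.1 (by
    have : 0 < n.size := Nat.size_pos.2 (by omega)
    omega)
  have h2 : ((n.size - 1 : ℕ) : ℝ) * Real.log 2 ≤ Real.log n := by
    rw [← Real.log_pow]
    exact Real.log_le_log (by positivity) (by exact_mod_cast h1)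
  have h3 : (n.size : ℝ) ≤ ((n.size - 1 : ℕ) : ℝ) + 1 := by
    norm_cast; omega
  rw [Real.norm_of_nonneg (by positivity), Real.norm_of_nonneg (hlog2.le.trans hlog)]
  push_cast
  rw [mul_assoc]
  refine mul_le_mul_of_nonneg_left ?_ (by positivity)
  rw [← add_div, div_mul_eq_mul_div, le_div_iff₀ hlog2]
  nlinarith

theorem mainTheorem7 (L : FirstOrder.Language.{u, v}) [L.IsRelational] [Finite L.Symbols]
    [Nonempty L.Symbols] (φ : STCCFormula L)
    (p q : ℕ) (x : Fin p → ℕ) (ι : Fin q → ℕ)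
    (hx : Function.Injective x) (hι : Function.Injective ι)
    (hdom : φ.freeDom ⊆ Set.range x) (hnum : φ.freeNum ⊆ Set.range ι) :
    ∃ (k : ℕ) (f : ℕ → ℕ),
      (fun n : ℕ => (f n : ℝ)) =O[atTop] (fun n : ℕ => Real.log n) ∧
      ∀ n : ℕ, ∃ ψ : (Fin q → Fin (n + 1)) → CFormula L,
        (∀ m, ψ m ∈ CLogic L k (f n) ∧ (ψ m).free ⊆ Set.range x) ∧
        ∀ (A : Type w) [L.Structure A] [Finite A] [Nonempty A] (hA : Nat.card A ≤ n)
          (a : Fin p → A) (i : Fin q → NumSort A) (α : ℕ → A) (β : ℕ → NumSort A),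
          φ.Sat (Function.extend x a α) (Function.extend ι i β) ↔
            (ψ (fun j => Fin.castLE (Nat.succ_le_succ hA) (i j))).Sat
              (Function.extend x a α) := by
  obtain ⟨k, C, -, -, h⟩ := φ.translatable
  refine ⟨k, fun n => C * (n.size + 1), isBigO_size_log C, fun n => ?_⟩
  obtain ⟨ψ, h1, h2⟩ := h n
  -- Number variables outside `ι` are set to 0; this is harmless since they are not free in `φ`.
  refine ⟨fun m => ψ (Function.extend ι (fun j => (m j : ℕ)) fun _ => 0),
    fun m => ⟨⟨(h1 _).1, (h1 _).2⟩, (h1 _).3.trans hdom⟩, fun A _ _ _ hA a i α β => ?_⟩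
  have h3 : φ.Sat (Function.extend x a α) (Function.extend ι i β) ↔
      φ.Sat (Function.extend x a α) (Function.extend ι i fun _ => 0) := by
    refine φ.sat_congr_num _ fun m hm => ?_
    obtain ⟨j, rfl⟩ := hnum hm
    rw [hι.extend_apply, hι.extend_apply]
  rw [h3, h2 A hA, STCCFormula.val_extend]
  rfl
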